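/- Let $(\Omega,\mathcal F,\mu)$ be a probability space, $N$ a finite set of players and $l$ a positive integer; put $C=\mathbb R_+^l$. Each player $i\in N$ has an information field $\mathcal F_i$, a sub-$\sigma$-algebra of $\mathcal F$, such that $\bigvee_{i\in N}\mathcal F_i$ is generated by a finite partition of $\Omega$; an $\mathcal F_i$-measurable initial endowment $e_i:\Omega\to C$; and a utility function $\psi_i:C\times\Omega\to\mathbb R_+$ that is $\mathfrak B(C)\otimes\mathcal F$-measurable and satisfies $\sup_{a\in C}|\psi_i(a,w)|\le g_i(w)$ for almost every $w$, for some $\mu$-integrable function $g_i$. For $z:\Omega\to C$ write $\Psi_i(z)(w)=\psi_i(z(w),w)$. Events with $\mu$-null symmetric difference are identified. For a coalition $S\subseteq N$ let $\mathcal T_S$ be the set of tuples $(x_i)_{i\in S}$ of functions $x_i:\Omega\to C$ such that $x_i$ is $\mathcal F_i$-measurable for each $i\in S$ and $\sum_{i\in S}x_i(w)=\sum_{i\in S}e_i(w)$ for a.e. $w\in\Omega$. A nonempty coalition $S$ blocks $x\in\mathcal T_N$ if there exist an event $F\in\bigwedge_{i\in S}\mathcal F_i=\bigcap_{i\in S}\mathcal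 F_i$ with $\mu(F)>0$ and an allocation $y\in\mathcal T_S$ such that $$E(\Psi_i(y_i)\mid\mathcal F_i)(w)>E(\Psi_i(x_i)\mid\mathcal F_i)(w)\quad\text{for a.e. } w\in F,\ \text{for all } i\in S.$$ The interim core is the set of those $x\in\mathcal T_N$ that no nonempty coalition blocks. If, for every $i\in N$ and every $w\in\Omega$, the function $\psi_i(\cdot,w)$ is concave and upper semicontinuous on $C$, then the interim core is nonempty. -/

import Mathlib

open MeasureTheory

/-- The consumption set `ℝ₊ˡ`. -/
def consumptionSet (l : ℕ) : Set (Fin l → ℝ) := Set.Ici 0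

/-- An exchange economy with incomplete information and interim contract delivery: the set of
players is `N`, there are `l` commodities, and `μ` is the common prior on the states `Ω`.
Endowments are automatically integrable, as they take finitely many values. -/
structure InterimEconomy {Ω : Type*} [MeasurableSpace Ω] (μ : Measure Ω) (N : Type*) (l : ℕ) where
  /-- the information field of each player -/
  info : N → MeasurableSpace Ω
  /-- information fields consist of events -/
  info_le : ∀ i, info i ≤ ‹MeasurableSpace Ω›
  /-- the join of the information fields is generated by a finite partition -/
  info_finite : ∃ P : Set (Set Ω), P.Finite ∧ Setoid.IsPartition P ∧
    ⨆ i, info i = MeasurableSpace.generateFrom P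
  /-- the initial endowment of each player -/
  endow : N → Ω → Fin l → ℝ
  endow_mem : ∀ i w, endow i w ∈ consumptionSet l
  /-- a player knows his endowment at the interim stage -/
  endow_measurable : ∀ i, Measurable[info i] (endow i)
  /-- the state-dependent utility of each player; only its values on `consumptionSet l` matter -/
  util : N → (Fin l → ℝ) → Ω → ℝ
  util_nonneg : ∀ i, ∀ a ∈ consumptionSet l, ∀ w, 0 ≤ util i a w
  /-- joint measurability on `ℝ₊ˡ × Ω` -/
  util_measurable : ∀ i, Measurable fun p : consumptionSet l × Ω => util i p.1 p.2
  /-- the supremum of the utility over the consumption set is integrably bounded -/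
  util_bounded : ∀ i, ∃ g : Ω → ℝ, Integrable g μ ∧
    ∀ᵐ w ∂μ, ∀ a ∈ consumptionSet l, |util i a w| ≤ g w

namespace InterimEconomy

variable {Ω : Type*} [MeasurableSpace Ω] {μ : Measure Ω} {N : Type*} {l : ℕ}

/-- The admissible allocations of a coalition `S`. Only the coordinates `x i` with `i ∈ S` are
meaningful (and constrained). -/
def allocations (E : InterimEconomy μ N l) (S : Finset N) : Set (N → Ω → Fin l → ℝ) :=
  {x | (∀ i ∈ S, (∀ w, x i w ∈ consumptionSet l) ∧ Measurable[E.info i] (x i)) ∧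
    ∀ᵐ w ∂μ, ∑ i ∈ S, x i w = ∑ i ∈ S, E.endow i w}

/-- The interim expected utility of player `i` at `z : Ω → ℝ₊ˡ`, that is, the conditional
expectation of `w ↦ util i (z w) w` given the information field of `i`. -/
noncomputable def interimUtility (E : InterimEconomy μ N l) (i : N) (z : Ω → Fin l → ℝ) : Ω → ℝ :=
  μ[fun w => E.util i (z w) w | E.info i]

/-- `F` is a common-knowledge event of the coalition `S`: it belongs to the information field of
each member, where events with a null symmetric difference are identified. -/
def IsCommonKnowledge (E : InterimEconomy μ N l) (S : Finset N) (F : Set Ω) : Prop :=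
  MeasurableSet F ∧ ∀ i ∈ S, ∃ G : Set Ω, MeasurableSet[E.info i] G ∧ F =ᵐ[μ] G

/-- The (nonempty) coalition `S` blocks `x`: on some non-null common-knowledge event `F` of `S`,
an admissible allocation `y` of `S` gives almost surely a strictly larger interim utility to every
member of `S`. -/
def Blocks (E : InterimEconomy μ N l) (S : Finset N) (x : N → Ω → Fin l → ℝ) : Prop :=
  S.Nonempty ∧ ∃ F : Set Ω, E.IsCommonKnowledge S F ∧ μ F ≠ 0 ∧
    ∃ y ∈ E.allocations S, ∀ i ∈ S,
      ∀ᵐ w ∂μ, w ∈ F → E.interimUtility i (x i) w < E.interimUtility i (y i) w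

/-- The interim core: the admissible allocations of the grand coalition that no coalition blocks. -/
def interimCore [Fintype N] (E : InterimEconomy μ N l) : Set (N → Ω → Fin l → ℝ) :=
  {x | x ∈ E.allocations Finset.univ ∧ ∀ S : Finset N, ¬ E.Blocks S x}

end InterimEconomy

/-! Following Harsanyi, each player is split into types: a player together with an atom of that
player's information, null atoms of the joint information being discarded. There are finitely many
types. A type values a bundle by the integral of the owner's utility over the atom, which is
nonnegative, concave and has closed superlevel sets. Integrating interim utilities over atoms turns
a block into an `Objection` that all types involved strictly prefer, so a core allocation for the
types suffices (`exists_mem_core_of_types`).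

Type allocations form a compact set and resisting one objection is a closed condition, so finitely
many objections may be treated at a time (`exists_allocation_of_finset`). Scarf's theorem
(`exists_balanced_weights_threshold`) then supplies balanced weights on objections and singletons,
and a threshold `u t` per type: positively weighted objections reach it at all their types, and no
objection exceeds it at all of its types. The weighted average of the bundles is again an
allocation, since objections preserve endowment totals state by state, and by concavity it gives
each type at least `u t`.

Scarf's theorem rests on a parity argument that plays linear-programming pivots on feasible bases
against ordinal pivots on dominating sets (`exists_feasible_dominating`). Genericity of the
right-hand side is removed by compactness. -/

/-! ### Ordinal pivoting and Scarf's parity argument -/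

section Scarf

variable {T K J L : Type*} [LinearOrder L]

/-- A set `D` of columns is dominating if no column is strictly better in every row than the
row minima of `D`. -/
def Dominating (rk : T → J → L) (D : Finset J) : Prop :=
  ∀ c, ∃ t, ∀ d ∈ D, rk t c ≤ rk t d

theorem Dominating.mono {rk : T → J → L} {D E : Finset J} (h : Dominating rk D) (hED : E ⊆ D) :
    Dominating rk E := fun c => (h c).imp fun _ ht d hd => ht d (hED hd)

/-- Columns better than the row minima `e` in every row other than `p`. -/
def betterExcept (rk : T → J → L) (e : T → J) (p : T) : Set J :=
  {c | ∀ t, t ≠ p → rk t (e t) < rk t c}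

/-- A column outside `betterExcept` is already dominated in a row other than `p`, where adding `k`
does not lower the minimum. A column inside it is dominated in row `p`, whose new minimum is `k`. -/
theorem dominating_insert_of_max [DecidableEq J] {rk : T → J → L} {E : Finset J} {e : T → J}
    (heE : ∀ t, e t ∈ E) (hmin : ∀ t, ∀ d ∈ E, rk t (e t) ≤ rk t d)
    (hE : Dominating rk E) {p : T} (hp : ∀ d ∈ E, ∃ t, t ≠ p ∧ e t = d) {k : J}
    (hk : k ∈ betterExcept rk e p) (hmax : ∀ c ∈ betterExcept rk e p, rk p c ≤ rk p k) :
    k ∉ E ∧ Dominating rk (insert k E) := by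
  refine ⟨fun hkE => ?_, fun c => ?_⟩
  · obtain ⟨t, htp, rfl⟩ := hp k hkE
    exact lt_irrefl _ (hk t htp)
  · by_cases hc : c ∈ betterExcept rk e p
    · have hkp : ∀ d ∈ E, rk p k ≤ rk p d := by
        obtain ⟨t, ht⟩ := hE k
        by_cases htp : t = p
        · exact htp ▸ ht
        · exact absurd (ht _ (heE t)) (not_le.2 (hk t htp))
      refine ⟨p, fun d hd => ?_⟩
      rcases Finset.mem_insert.1 hd with rfl | hd
      · exact hmax c hc
      · exact (hmax c hc).trans (hkp d hd)
    · simp only [betterExcept, Set.mem_ofPred_eq, not_forall, not_lt] at hc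
      obtain ⟨t, htp, hc⟩ := hc
      refine ⟨t, fun d hd => ?_⟩
      rcases Finset.mem_insert.1 hd with rfl | hd
      · exact hc.trans (hk t htp).le
      · exact hc.trans (hmin t d hd)

/-- Converse pivot. Each `e t` must still attain the minimum of some row after `k` enters; for `t ≠
p` injectivity of `e` off `p` makes this row `t`, so `k` lies above `e t` there. A column of
`betterExcept` can then only be dominated in row `p`. -/
theorem max_of_dominating_insert [DecidableEq J] {rk : T → J → L}
    (hrk : ∀ t, Function.Injective (rk t)) {E : Finset J} {e : T → J}
    (heE : ∀ t, e t ∈ E) (hmin : ∀ t, ∀ d ∈ E, rk t (e t) ≤ rk t d)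
    {k : J} (hkE : k ∉ E) (hD : Dominating rk (insert k E)) {p : T}
    (hkp : ∀ d ∈ insert k E, rk p k ≤ rk p d) (hp : ∀ s t, s ≠ p → t ≠ p → e s = e t → s = t) :
    k ∈ betterExcept rk e p ∧ ∀ c ∈ betterExcept rk e p, rk p c ≤ rk p k := by
  have hlt : ∀ t, t ≠ p → rk t (e t) < rk t k := by
    intro t htp
    obtain ⟨s, hs⟩ := hD (e t)
    have hst : e t = e s :=
      hrk s (le_antisymm (hs _ (Finset.mem_insert_of_mem (heE s))) (hmin s _ (heE t)))
    have hsp : s ≠ p := by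
      rintro rfl
      have := hrk s (le_antisymm (hs k (Finset.mem_insert_self _ _))
        (hkp _ (Finset.mem_insert_of_mem (heE t))))
      exact hkE (this ▸ heE t)
    obtain rfl := hp t s htp hsp hst
    refine lt_of_le_of_ne (hs k (Finset.mem_insert_self _ _)) fun h => hkE ?_
    exact hrk t h ▸ heE t
  refine ⟨hlt, fun c hc => ?_⟩
  obtain ⟨t, ht⟩ := hD c
  by_cases htp : t = p
  · subst htp
    exact ht k (Finset.mem_insert_self _ _)
  · exact absurd (ht _ (Finset.mem_insert_of_mem (heE t))) (not_le.2 (hc t htp))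

-- If `E` dominates, each of its columns is a row minimum; having one column fewer than there are
-- rows, exactly two rows `p`, `q` share theirs. The extensions are the best columns for `p` and for
-- `q`, so there are two or none.
open Classical in
theorem even_card_dominating_insert [Fintype T] [Fintype K] {rk : T → T ⊕ K → L}
    (hrk : ∀ t, Function.Injective (rk t))
    (hhigh : ∀ t s k, s ≠ t → rk t (Sum.inr k) < rk t (Sum.inl s))
    {E : Finset (T ⊕ K)} (hcard : E.card + 1 = Fintype.card T) {k₀ : K} (hk₀ : Sum.inr k₀ ∈ E) :
    Even (Finset.univ.filter fun k => k ∉ E ∧ Dominating rk (insert k E)).card := by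
  by_cases hE : Dominating rk E
  swap
  · rw [Finset.filter_false_of_mem]
    · simp
    · rintro k - ⟨-, h⟩
      exact hE (h.mono (Finset.subset_insert _ _))
  have hex : ∀ t, ∃ j ∈ E, ∀ d ∈ E, rk t j ≤ rk t d := fun t =>
    Finset.exists_min_image E (rk t) ⟨_, hk₀⟩
  choose e heE hmin using hex
  have hsurj : ∀ d ∈ E, ∃ t, e t = d := by
    intro d hd
    obtain ⟨t, ht⟩ := hE d
    exact ⟨t, hrk t (le_antisymm (hmin t d hd) (ht _ (heE t)))⟩
  obtain ⟨p, -, q, -, hpq, hepq⟩ : ∃ p ∈ Finset.univ, ∃ q ∈ Finset.univ, p ≠ q ∧ e p = e q :=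
    Finset.exists_ne_map_eq_of_card_lt_of_maps_to (t := E)
      (by rw [Finset.card_univ]; omega) (fun t _ => heE t)
  have hsurj' : ∀ p q, p ≠ q → e p = e q → ∀ d ∈ E, ∃ t, t ≠ p ∧ e t = d := by
    intro p q hpq hepq d hd
    obtain ⟨t, ht⟩ := hsurj d hd
    by_cases htp : t = p
    · exact ⟨q, hpq.symm, by rw [← hepq, ← htp, ht]⟩
    · exact ⟨t, htp, ht⟩
  have hinj : ∀ p q, p ≠ q → e p = e q → ∀ s t, s ≠ p → t ≠ p → e s = e t → s = t := by
    intro p q hpq hepq s t hs ht hst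
    have := Finset.inj_on_of_surj_on_of_card_le (s := Finset.univ.erase p) (t := E)
      (fun t _ => e t) (fun t _ => heE t)
      (fun d hd => by
        obtain ⟨t, h1, h2⟩ := hsurj' p q hpq hepq d hd
        exact ⟨t, by simp [h1], h2⟩)
      (by rw [Finset.card_erase_of_mem (Finset.mem_univ _), Finset.card_univ]; omega)
    exact this (a₁ := s) (a₂ := t) (by simp [hs]) (by simp [ht]) hst
  -- The column `inr k₀` keeps the row minima of `E` below the high entries of `inl p`, so
  -- candidates for entering exist.
  have hid : ∀ p, Sum.inl p ∈ betterExcept rk e p := by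
    intro p t htp
    exact (hmin t _ hk₀).trans_lt (hhigh t p k₀ htp.symm)
  have hmaxex : ∀ p, ∃ k ∈ betterExcept rk e p, ∀ c ∈ betterExcept rk e p, rk p c ≤ rk p k :=
    fun p => Set.exists_max_image _ (rk p) (Set.toFinite _) ⟨_, hid p⟩
  obtain ⟨kp, hkp, hkpmax⟩ := hmaxex p
  obtain ⟨kq, hkq, hkqmax⟩ := hmaxex q
  have hne : kp ≠ kq := by
    rintro rfl
    obtain ⟨t, ht⟩ := hE kp
    by_cases htp : t = p
    · exact absurd (ht _ (heE t)) (not_le.2 (hkq t (htp ▸ hpq)))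
    · exact absurd (ht _ (heE t)) (not_le.2 (hkp t htp))
  have : (Finset.univ.filter fun k => k ∉ E ∧ Dominating rk (insert k E)) = {kp, kq} := by
    ext k
    simp only [Finset.mem_filter, Finset.mem_univ, true_and, Finset.mem_insert,
      Finset.mem_singleton]
    constructor
    -- Let `k` be minimal in row `r`. The displaced column `e r` must be minimal in another row `t`,
    -- so `r` is one of the two rows sharing a minimum.
    · rintro ⟨hkE, hD⟩
      obtain ⟨r, hr⟩ := hD k
      obtain ⟨t, ht⟩ := hD (e r)
      have htr : e r = e t :=
        hrk t (le_antisymm (ht _ (Finset.mem_insert_of_mem (heE t))) (hmin t _ (heE r)))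
      have hne : t ≠ r := by
        rintro rfl
        have := hrk t (le_antisymm (ht k (Finset.mem_insert_self _ _))
          (hr _ (Finset.mem_insert_of_mem (heE t))))
        exact hkE (this ▸ heE t)
      have hrpq : r = p ∨ r = q := by
        by_contra! h
        by_cases htp : t = p
        · subst htp
          exact h.2 (hinj t q hpq hepq r q h.1 hpq.symm (htr.trans hepq))
        · exact hne (hinj p q hpq hepq t r htp h.1 htr.symm)
      rcases hrpq with rfl | rfl
      · left
        obtain ⟨h1, h2⟩ := max_of_dominating_insert hrk heE hmin hkE hD hr (hinj r q hpq hepq)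
        exact hrk r (le_antisymm (hkpmax k h1) (h2 kp hkp))
      · right
        obtain ⟨h1, h2⟩ := max_of_dominating_insert hrk heE hmin hkE hD hr
          (hinj r p hpq.symm hepq.symm)
        exact hrk r (le_antisymm (hkqmax k h1) (h2 kq hkq))
    · rintro (rfl | rfl)
      · exact dominating_insert_of_max heE hmin hE (hsurj' p q hpq hepq) hkp hkpmax
      · exact dominating_insert_of_max heE hmin hE (hsurj' q p hpq.symm hepq.symm) hkq hkqmax
  rw [this, Finset.card_pair hne]
  exact even_two

-- For `t ≠ r` the least entry of row `t` is `inl t ∈ E`, so columns outside `E` can only be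
-- dominated in row `r`. This forces `k` to be the largest of them in row `r`.
open Classical in
theorem card_dominating_insert_inl [Fintype T] [Fintype K] {rk : T → T ⊕ K → L}
    (hrk : ∀ t, Function.Injective (rk t))
    (hlow : ∀ t k, rk t (Sum.inl t) < rk t (Sum.inr k))
    (hhigh : ∀ t s k, s ≠ t → rk t (Sum.inr k) < rk t (Sum.inl s))
    (hlow' : ∀ t s, rk t (Sum.inl t) ≤ rk t (Sum.inl s)) (r : T)
    {E : Finset (T ⊕ K)} (hE : E = (Finset.univ.image Sum.inl).erase (Sum.inl r)) :
    (Finset.univ.filter fun k => k ∉ E ∧ Dominating rk (insert k E)).card = 1 := by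
  have hmem : ∀ j, j ∈ E ↔ ∃ t, t ≠ r ∧ j = Sum.inl t := by
    intro j
    rw [hE]
    rcases j with j | j <;> simp
  have hlt : ∀ t j, rk t (Sum.inl t) ≤ rk t j := by
    rintro t (s | k)
    · exact hlow' t s
    · exact (hlow t k).le
  obtain ⟨m, hm, hmax⟩ := Set.exists_max_image {j | j ∉ E} (rk r) (Set.toFinite _)
    ⟨Sum.inl r, fun h => by
      obtain ⟨t, ht, h⟩ := (hmem _).1 h
      exact ht (Sum.inl_injective h).symm⟩
  rw [Finset.card_eq_one]
  refine ⟨m, ?_⟩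
  have hsmall : ∀ j, j ∉ E → ∀ d ∈ E, rk r j ≤ rk r d := by
    intro j hj d hd
    obtain ⟨s, hs, rfl⟩ := (hmem d).1 hd
    rcases j with t | k
    · have : t = r := by
        by_contra h
        exact hj ((hmem _).2 ⟨t, h, rfl⟩)
      exact this ▸ hlow' t s
    · exact (hhigh r s k hs).le
  ext k
  simp only [Finset.mem_filter, Finset.mem_univ, true_and, Finset.mem_singleton]
  constructor
  · rintro ⟨hk, hD⟩
    obtain ⟨t, ht⟩ := hD m
    by_cases htr : t = r
    · subst htr
      exact hrk t (le_antisymm (hmax k hk) (ht k (Finset.mem_insert_self _ _)))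
    · have h1 := ht (Sum.inl t) (Finset.mem_insert_of_mem ((hmem _).2 ⟨t, htr, rfl⟩))
      have := hrk t (le_antisymm h1 (hlt t m))
      exact absurd ((hmem _).2 ⟨t, htr, this⟩) hm
  · rintro rfl
    refine ⟨hm, fun c => ?_⟩
    by_cases hc : c ∈ E
    · obtain ⟨t, -, rfl⟩ := (hmem c).1 hc
      exact ⟨t, fun d _ => hlt t d⟩
    · refine ⟨r, fun d hd => ?_⟩
      rcases Finset.mem_insert.1 hd with rfl | hd
      · exact hmax c hc
      · exact hsmall c hc d hd

-- Fix `a = inl r` and join feasible `B ∋ a` to dominating `O ∌ a` when `B ⊆ insert a O`. If no set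
-- were both feasible and dominating, all degrees would be even except that of the set of all `inl
-- t`, which is one; counting edges from both sides gives a contradiction.
open Classical in
theorem exists_feasible_dominating [Fintype T] [Nonempty T] [Fintype K] {rk : T → T ⊕ K → L}
    (hrk : ∀ t, Function.Injective (rk t))
    (hlow : ∀ t k, rk t (Sum.inl t) < rk t (Sum.inr k))
    (hhigh : ∀ t s k, s ≠ t → rk t (Sum.inr k) < rk t (Sum.inl s))
    (hlow' : ∀ t s, rk t (Sum.inl t) ≤ rk t (Sum.inl s))
    (Feas : Finset (T ⊕ K) → Prop) (hcard : ∀ D, Feas D → D.card = Fintype.card T)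
    (heven : ∀ G : Finset (T ⊕ K), G.card = Fintype.card T + 1 →
      Even (G.filter fun g => Feas (G.erase g)).card)
    (hid : Feas (Finset.univ.image Sum.inl)) :
    ∃ D, Feas D ∧ Dominating rk D := by
  by_contra! hno
  obtain ⟨r⟩ := ‹Nonempty T›
  set a : T ⊕ K := Sum.inl r with ha
  set I : Finset (T ⊕ K) := Finset.univ.image Sum.inl with hI
  have haI : a ∈ I := by simp [hI, ha]
  let FB : Finset (Finset (T ⊕ K)) := Finset.univ.filter fun B => Feas B ∧ a ∈ B
  let FO : Finset (Finset (T ⊕ K)) := Finset.univ.filter fun O =>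
    O.card = Fintype.card T ∧ Dominating rk O ∧ a ∉ O
  let R : Finset (T ⊕ K) → Finset (T ⊕ K) → Prop := fun B O => B ⊆ insert a O
  have hdc := Finset.sum_card_bipartiteAbove_eq_sum_card_bipartiteBelow R (s := FB) (t := FO)
  have hO : ∀ O ∈ FO, Even (Finset.bipartiteBelow R FB O).card := by
    intro O hO
    obtain ⟨hOc, hOd, haO⟩ := (Finset.mem_filter.1 hO).2
    have hG : (insert a O).card = Fintype.card T + 1 := by
      rw [Finset.card_insert_of_notMem haO, hOc]
    have heq : Finset.bipartiteBelow R FB O =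
        ((insert a O).filter fun g => Feas ((insert a O).erase g)).image (insert a O).erase := by
      ext B
      simp only [Finset.bipartiteBelow, Finset.mem_filter, Finset.mem_univ, true_and, FB, R,
        Finset.mem_image]
      constructor
      · rintro ⟨⟨hB, haB⟩, hsub⟩
        obtain ⟨g, hg, hgB⟩ := Finset.exists_eq_insert_iff.2 ⟨hsub, by rw [hG, hcard B hB]⟩
        have : (insert a O).erase g = B := by rw [← hgB, Finset.erase_insert hg]
        exact ⟨g, ⟨hgB ▸ Finset.mem_insert_self _ _, this ▸ hB⟩, this⟩
      · rintro ⟨g, ⟨hg, hF⟩, rfl⟩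
        refine ⟨⟨hF, ?_⟩, Finset.erase_subset _ _⟩
        refine Finset.mem_erase.2 ⟨?_, Finset.mem_insert_self _ _⟩
        rintro rfl
        rw [Finset.erase_insert haO] at hF
        exact hno O hF hOd
    rw [heq, Finset.card_image_of_injOn]
    · exact heven _ hG
    · exact (Finset.erase_injOn _).mono fun g hg => (Finset.mem_filter.1 hg).1
  have hB : ∀ B ∈ FB, (Finset.bipartiteAbove R FO B).card =
      (Finset.univ.filter fun k => k ∉ B.erase a ∧ Dominating rk (insert k (B.erase a))).card := by
    intro B hB
    obtain ⟨hBF, haB⟩ := (Finset.mem_filter.1 hB).2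
    have hBc := hcard B hBF
    have hEc : (B.erase a).card + 1 = Fintype.card T := by
      rw [Finset.card_erase_add_one haB, hBc]
    have heq : Finset.bipartiteAbove R FO B =
        (Finset.univ.filter fun k => k ∉ B.erase a ∧
          Dominating rk (insert k (B.erase a))).image fun k => insert k (B.erase a) := by
      ext O
      simp only [Finset.bipartiteAbove, Finset.mem_filter, Finset.mem_univ, true_and, FO, R,
        Finset.mem_image]
      constructor
      · rintro ⟨⟨hOc, hOd, haO⟩, hsub⟩
        have hsub' : B.erase a ⊆ O := by
          intro j hj
          obtain ⟨hja, hj⟩ := Finset.mem_erase.1 hj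
          exact (Finset.mem_insert.1 (hsub hj)).resolve_left hja
        obtain ⟨k, hk, hkO⟩ := Finset.exists_eq_insert_iff.2 ⟨hsub', by rw [hOc, hEc]⟩
        exact ⟨k, ⟨hk, hkO ▸ hOd⟩, hkO⟩
      · rintro ⟨k, ⟨hk, hD⟩, rfl⟩
        refine ⟨⟨by rw [Finset.card_insert_of_notMem hk, hEc], hD, ?_⟩, ?_⟩
        · intro h
          rcases Finset.mem_insert.1 h with h | h
          · subst h
            rw [Finset.insert_erase haB] at hD
            exact hno B hBF hD
          · simp at h
        · intro j hj
          by_cases hja : j = a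
          · simp [hja]
          · simp [hja, hj]
    rw [heq, Finset.card_image_of_injOn]
    intro k hk k' hk' h
    simp only [Finset.coe_filter, Finset.mem_univ, true_and, Set.mem_ofPred_eq] at hk hk'
    exact (Finset.insert_inj hk.1).1 h
  have hIB : I ∈ FB := by simp [FB, hid, haI]
  have hodd : Odd (∑ B ∈ FB, (Finset.bipartiteAbove R FO B).card) := by
    rw [← Finset.add_sum_erase _ _ hIB, hB I hIB,
      card_dominating_insert_inl hrk hlow hhigh hlow' r (by rw [ha])]
    refine odd_one.add_even (Finset.even_sum _ fun B hB' => ?_)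
    obtain ⟨hBI, hBF⟩ := Finset.mem_erase.1 hB'
    rw [hB B hBF]
    obtain ⟨hF, haB⟩ := (Finset.mem_filter.1 hBF).2
    obtain ⟨k₀, hk₀⟩ : ∃ k, Sum.inr k ∈ B := by
      by_contra! h
      refine hBI (Finset.eq_of_subset_of_card_le ?_ ?_)
      · rintro (t | k) hj
        · simp [hI]
        · exact absurd hj (h k)
      · rw [hcard B hF, hcard I hid]
    exact even_card_dominating_insert hrk hhigh
      (by rw [Finset.card_erase_add_one haB, hcard B hF]) (k₀ := k₀) (by simp [ha, hk₀])
  rw [hdc] at hodd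
  exact (Nat.not_even_iff_odd.2 hodd) (Finset.even_sum _ hO)

end Scarf

/-! ### Feasible bases and linear-programming pivots -/

section Feasible

variable {T J : Type*} [Fintype T] [Fintype J]

/-- The set `D` of `card T` columns supports a nonnegative solution of `∑ x j • a j = b`. -/
def IsFeasibleBasis (a : J → T → ℝ) (b : T → ℝ) (D : Finset J) : Prop :=
  D.card = Fintype.card T ∧ ∃ x : J → ℝ, (∀ j, 0 ≤ x j) ∧ (∀ j, j ∉ D → x j = 0) ∧
    ∑ j, x j • a j = b

/-- `b` does not lie in the span of fewer than `card T` columns. -/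
def IsGenericFor (a : J → T → ℝ) (b : T → ℝ) : Prop :=
  ∀ D : Finset J, D.card < Fintype.card T → b ∉ Submodule.span ℝ (a '' D)

theorem IsGenericFor.card_le {a : J → T → ℝ} {b : T → ℝ} (hb : IsGenericFor a b) {x : J → ℝ}
    {D : Finset J} (hx : ∀ j, j ∉ D → x j = 0) (hsum : ∑ j, x j • a j = b) :
    Fintype.card T ≤ D.card := by
  by_contra! h
  refine hb D h ?_
  rw [← hsum]
  refine Submodule.sum_mem _ fun j _ => ?_
  by_cases hj : j ∈ D
  · exact Submodule.smul_mem _ _ (Submodule.subset_span ⟨j, hj, rfl⟩)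
  · simp [hx j hj]

theorem exists_relation_of_card {a : J → T → ℝ} {G : Finset J}
    (hG : G.card = Fintype.card T + 1) :
    ∃ v : J → ℝ, (∀ j, j ∉ G → v j = 0) ∧ ∑ j, v j • a j = 0 ∧ ∃ j, v j ≠ 0 := by
  classical
  have hdep : ¬ LinearIndependent ℝ (fun j : G => a j) := by
    intro h
    have := h.fintype_card_le_finrank
    simp [hG] at this
  obtain ⟨w, hw, ⟨i, hi⟩, hne⟩ := Fintype.not_linearIndependent_iff.1 hdep
  refine ⟨fun j => if h : j ∈ G then w ⟨j, h⟩ else 0, fun j hj => by simp [hj], ?_,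
    i, by simpa [hi] using hne⟩
  rw [← hw, ← Finset.sum_subset (Finset.subset_univ G), ← Finset.sum_coe_sort G]
  · exact Finset.sum_congr rfl fun j _ => by simp
  · intro j _ hj
    simp [hj]

-- The solutions supported on `G` form a line, and the nonnegative ones a bounded segment. By
-- genericity exactly one coordinate of `G` vanishes at each endpoint, so the number of feasible
-- bases inside `G` is two or zero.
open Classical in
theorem IsGenericFor.even_card_feasible {a : J → T → ℝ} {b : T → ℝ} (hb : IsGenericFor a b)
    (ha : ∀ j, 0 < ∑ t, a j t) {G : Finset J} (hG : G.card = Fintype.card T + 1) :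
    Even (G.filter fun g => IsFeasibleBasis a b (G.erase g)).card := by
  by_cases hex : ∃ g ∈ G, IsFeasibleBasis a b (G.erase g)
  swap
  · rw [Finset.filter_false_of_mem fun g hg h => hex ⟨g, hg, h⟩]
    simp
  obtain ⟨g₀, hg₀, -, x, hx0, hxs, hxb⟩ := hex
  have hxG : ∀ j, j ∉ G → x j = 0 := fun j hj => hxs j fun h => hj (Finset.mem_of_mem_erase h)
  have hxg₀ : x g₀ = 0 := hxs g₀ (by simp)
  -- a solution supported on `G` has at most one zero in `G`
  have huniq : ∀ z : J → ℝ, (∀ j, j ∉ G → z j = 0) → ∑ j, z j • a j = b →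
      ∀ g ∈ G, ∀ h ∈ G, z g = 0 → z h = 0 → g = h := by
    intro z hz hzb g hg h hh hzg hzh
    by_contra hne
    have := hb.card_le (x := z) (D := (G.erase g).erase h) (fun j hj => by
      by_cases hjh : j = h
      · rw [hjh, hzh]
      by_cases hjg : j = g
      · rw [hjg, hzg]
      refine hz j fun hjG => hj ?_
      simp [hjh, hjg, hjG]) hzb
    rw [Finset.card_erase_of_mem (Finset.mem_erase.2 ⟨Ne.symm hne, hh⟩),
      Finset.card_erase_of_mem hg] at this
    have h1 : 1 ≤ (G.erase g).card := Finset.card_pos.2 ⟨h, Finset.mem_erase.2 ⟨Ne.symm hne, hh⟩⟩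
    rw [Finset.card_erase_of_mem hg] at h1
    omega
  -- the kernel elements vanishing at `g₀` are trivial
  have hker : ∀ v : J → ℝ, (∀ j, j ∉ G → v j = 0) → ∑ j, v j • a j = 0 → v g₀ = 0 → v = 0 := by
    intro v hv hva hvg
    ext h
    by_contra hh
    simp only [Pi.zero_apply] at hh
    have hhG : h ∈ G := by
      by_contra h'
      exact hh (hv h h')
    -- The multiple of `v` is chosen so that the new solution vanishes at both `g₀` and `h`.
    have hne : g₀ = h := huniq (fun j => x j - x h / v h * v j)
      (fun j hj => by simp [hxG j hj, hv j hj])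
      (by simp only [sub_smul, mul_smul, Finset.sum_sub_distrib, ← Finset.smul_sum, hva, hxb]; simp)
      g₀ hg₀ h hhG (by simp [hxg₀, hvg]) (by field_simp; simp)
    exact hh (hne ▸ hvg)
  obtain ⟨v, hvG, hva, hvpos⟩ : ∃ v : J → ℝ, (∀ j, j ∉ G → v j = 0) ∧ ∑ j, v j • a j = 0 ∧
      0 < v g₀ := by
    obtain ⟨v, h1, h2, j, hj⟩ := exists_relation_of_card (a := a) hG
    have hne : v g₀ ≠ 0 := fun h => hj (by rw [hker v h1 h2 h]; rfl)
    rcases lt_or_gt_of_ne hne with h | h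
    · exact ⟨fun j => - v j, fun j hj => by simp [h1 j hj], by simp [h2], by simpa using h⟩
    · exact ⟨v, h1, h2, h⟩
  -- Positive column sums force a sign change in the relation, which bounds the segment.
  have hneg : ∃ h ∈ G, v h < 0 := by
    by_contra! hcon
    have h0 : ∀ j, 0 ≤ v j := fun j => by
      by_cases hj : j ∈ G
      · exact hcon j hj
      · rw [hvG j hj]
    have hs : ∑ j, v j * ∑ t, a j t = 0 := by
      have : ∑ t, (∑ j, v j • a j) t = 0 := by rw [hva]; simp
      simp only [Finset.sum_apply, Pi.smul_apply, smul_eq_mul] at this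
      rw [Finset.sum_comm] at this
      simpa [Finset.mul_sum] using this
    have := (Finset.sum_eq_zero_iff_of_nonneg fun j _ => mul_nonneg (h0 j) (ha j).le).1 hs g₀
      (Finset.mem_univ _)
    exact (mul_pos hvpos (ha g₀)).ne' this
  -- Ratio test: `g₁` is the first coordinate to reach zero when moving from `x` along `v`.
  obtain ⟨g₁, hg₁, hmin⟩ := Finset.exists_min_image (G.filter fun h => v h < 0)
    (fun h => x h / (- v h)) (by
      obtain ⟨h, hh, hv⟩ := hneg
      exact ⟨h, by simp [hh, hv]⟩)
  obtain ⟨hg₁G, hvg₁⟩ := Finset.mem_filter.1 hg₁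
  set s := x g₁ / (- v g₁) with hs
  have hs0 : 0 ≤ s := div_nonneg (hx0 _) (by linarith)
  have hsum : ∀ s : ℝ, ∑ j, (x j + s * v j) • a j = b := by
    intro s
    simp only [add_smul, mul_smul, Finset.sum_add_distrib, ← Finset.smul_sum, hva, hxb]
    simp
  have hzero : x g₁ + s * v g₁ = 0 := by
    rw [hs, div_neg, neg_mul, div_mul_cancel₀ _ hvg₁.ne, add_neg_cancel]
  have hne : g₀ ≠ g₁ := by
    rintro rfl
    linarith
  have hcardE : ∀ g ∈ G, (G.erase g).card = Fintype.card T := fun g hg => by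
    rw [Finset.card_erase_of_mem hg, hG]; rfl
  have heq : (G.filter fun g => IsFeasibleBasis a b (G.erase g)) = {g₀, g₁} := by
    ext g
    simp only [Finset.mem_filter, Finset.mem_insert, Finset.mem_singleton]
    constructor
    · rintro ⟨hg, -, z, hz0, hzs, hzb⟩
      have hzG : ∀ j, j ∉ G → z j = 0 := fun j hj => hzs j fun h => hj (Finset.mem_of_mem_erase h)
      have hzg : z g = 0 := hzs g (by simp)
      by_contra! hcon
      set s' := z g₀ / v g₀ with hs'
      have hs'0 : 0 ≤ s' := div_nonneg (hz0 _) hvpos.le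
      have hz : ∀ j, z j = x j + s' * v j := by
        have := hker (fun j => z j - x j - s' * v j)
          (fun j hj => by simp [hzG j hj, hxG j hj, hvG j hj])
          (by simp only [sub_smul, mul_smul, Finset.sum_sub_distrib, ← Finset.smul_sum, hva, hxb,
                hzb]; simp)
          (by simp only [hxg₀, hs']; field_simp; simp)
        intro j
        have := congrFun this j
        simp only [Pi.zero_apply] at this
        linarith
      have hxg : 0 < x g := lt_of_le_of_ne (hx0 g) fun h =>
        hcon.1 (huniq x hxG hxb g hg g₀ hg₀ h.symm hxg₀)
      have hvg : v g < 0 := by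
        by_contra! hv
        have := mul_nonneg hs'0 hv
        have := hz g
        linarith
      have h1 : s ≤ x g / (- v g) := hmin g (by simp [hg, hvg])
      have h2 : x g / (- v g) = s' := by
        have := hz g
        rw [div_eq_iff (by linarith)]
        linarith
      have h3 : s' ≤ s := by
        rw [hs, le_div_iff₀ (by linarith)]
        have := hz g₁
        have := hz0 g₁
        linarith
      have h4 : s' = s := le_antisymm h3 (h2 ▸ h1)
      exact hcon.2 (huniq z hzG hzb g hg g₁ hg₁G hzg (by rw [hz g₁, h4, hzero]))
    · rintro (rfl | rfl)
      · exact ⟨hg₀, hcardE _ hg₀, x, hx0, hxs, hxb⟩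
      · refine ⟨hg₁G, hcardE _ hg₁G, fun j => x j + s * v j, fun j => ?_, fun j hj => ?_, hsum s⟩
        · by_cases hv : v j < 0
          · have hjG : j ∈ G := by
              by_contra h
              rw [hvG j h] at hv
              exact lt_irrefl _ hv
            have := hmin j (by simp [hjG, hv])
            rw [le_div_iff₀ (by linarith)] at this
            change 0 ≤ x j + s * v j
            linarith
          · push Not at hv
            exact add_nonneg (hx0 j) (mul_nonneg hs0 hv)
        · by_cases hjg : j = g
          · rw [hjg]
            exact hzero
          · have : j ∉ G := fun h => hj (Finset.mem_erase.2 ⟨hjg, h⟩)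
            simp [hxG j this, hvG j this]
  rw [heq, Finset.card_pair hne]
  exact even_two

/-- The exceptional vectors lie in finitely many proper subspaces, which are null sets. -/
theorem dense_isGenericFor (a : J → T → ℝ) : Dense {b | IsGenericFor a b} := by
  have h : ∀ᵐ b : T → ℝ, IsGenericFor a b := by
    simp only [IsGenericFor]
    rw [ae_all_iff]
    intro D
    by_cases hD : D.card < Fintype.card T
    · have hne : Submodule.span ℝ (a '' D) ≠ ⊤ := by
        intro h
        have h1 := finrank_span_finset_le_card (R := ℝ) (D.image a)
        rw [Set.finrank, Finset.coe_image, h, finrank_top, Module.finrank_fintype_fun_eq_card] at h1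
        have := Finset.card_image_le (s := D) (f := a)
        omega
      have := Measure.addHaar_submodule (volume : Measure (T → ℝ)) _ hne
      filter_upwards [measure_eq_zero_iff_ae_notMem.1 this] with b hb _
      exact hb
    · simp [hD]
  exact Measure.dense_of_ae h

end Feasible

/-! ### Balanced weights -/

section ScarfBalanced

variable {T K : Type*}

open Classical in
/-- The incidence vector of a column: `inl t` stands for the singleton `{t}`, and `inr k` for the
coalition `mem k`. -/
noncomputable def incidence (mem : K → Set T) (j : T ⊕ K) (t : T) : ℝ :=
  Sum.elim (fun s => if t = s then 1 else 0) (fun k => if t ∈ mem k then 1 else 0) j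

theorem incidence_nonneg (mem : K → Set T) (j : T ⊕ K) (t : T) : 0 ≤ incidence mem j t := by
  rcases j with s | k <;> simp only [incidence, Sum.elim_inl, Sum.elim_inr] <;> split_ifs <;> simp

theorem exists_incidence_eq_one {mem : K → Set T} (hmem : ∀ k, (mem k).Nonempty) (j : T ⊕ K) :
    ∃ t, incidence mem j t = 1 := by
  rcases j with s | k
  · exact ⟨s, by simp [incidence]⟩
  · obtain ⟨t, ht⟩ := hmem k
    exact ⟨t, by simp [incidence, ht]⟩

/-- The all-ones vector need not be generic, but it is a limit of generic vectors, and the vectors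
solvable on a dominating set with weights in a fixed box form a closed set. -/
theorem exists_balanced_dominating [Fintype T] [Nonempty T] [Fintype K] {L : Type*} [LinearOrder L]
    {rk : T → T ⊕ K → L} (hrk : ∀ t, Function.Injective (rk t))
    (hlow : ∀ t k, rk t (Sum.inl t) < rk t (Sum.inr k))
    (hhigh : ∀ t s k, s ≠ t → rk t (Sum.inr k) < rk t (Sum.inl s))
    (hlow' : ∀ t s, rk t (Sum.inl t) ≤ rk t (Sum.inl s))
    {mem : K → Set T} (hmem : ∀ k, (mem k).Nonempty) :
    ∃ (D : Finset (T ⊕ K)) (x : T ⊕ K → ℝ), Dominating rk D ∧ (∀ j, 0 ≤ x j) ∧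
      (∀ j, j ∉ D → x j = 0) ∧ ∀ t, ∑ j, x j * incidence mem j t = 1 := by
  classical
  let a := incidence mem
  -- The bound 2 suffices: every column has an entry 1, so a weight is at most a coordinate of `b`,
  -- and `b` is taken in `(0, 2)^T`.
  let Q : Finset (T ⊕ K) → Set (T ⊕ K → ℝ) := fun D => {x | ∀ j, j ∉ D → x j = 0} ∩ Set.Icc 0 2
  have hQ : ∀ D, IsCompact (Q D) := fun D => by
    refine isCompact_Icc.inter_left ?_
    simp only [Set.ofPred_forall]
    exact isClosed_iInter fun j => isClosed_iInter fun _ =>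
      isClosed_eq (continuous_apply j) continuous_const
  let f : (T ⊕ K → ℝ) → (T → ℝ) := fun x => ∑ j, x j • a j
  have hf : Continuous f := by fun_prop
  let Z : Set (T → ℝ) := ⋃ D ∈ {D | Dominating rk D}, f '' Q D
  have hZ : IsClosed Z := by
    refine (Set.toFinite _).isClosed_biUnion fun D _ => ?_
    exact ((hQ D).image hf).isClosed
  let U : Set (T → ℝ) := Set.univ.pi fun _ => Set.Ioo 0 2
  have hU : IsOpen U := isOpen_set_pi Set.finite_univ fun _ _ => isOpen_Ioo
  have hsub : U ∩ {b | IsGenericFor a b} ⊆ Z := by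
    rintro b ⟨hbU, hb⟩
    have hpos : ∀ j, 0 < ∑ t, a j t := fun j => by
      obtain ⟨t, ht⟩ := exists_incidence_eq_one hmem j
      refine Finset.sum_pos' (fun t _ => incidence_nonneg mem j t) ⟨t, Finset.mem_univ _, ?_⟩
      change 0 < incidence mem j t
      rw [ht]; exact one_pos
    have hb' : IsGenericFor a b := hb
    obtain ⟨D, ⟨-, x, hx0, hxD, hxb⟩, hD⟩ := exists_feasible_dominating hrk hlow hhigh hlow'
      (IsFeasibleBasis a b) (fun D h => h.1) (fun G hG => by
        convert hb'.even_card_feasible hpos hG) (by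
        refine ⟨by rw [Finset.card_image_of_injective _ Sum.inl_injective, Finset.card_univ],
          Sum.elim b 0, ?_, ?_, ?_⟩
        · rintro (t | k)
          · exact (hbU t trivial).1.le
          · simp
        · rintro (t | k) h
          · simp at h
          · simp
        · ext t
          simp [a, incidence, Fintype.sum_sum_type])
    refine Set.mem_biUnion (x := D) hD ⟨x, ⟨hxD, fun j => hx0 j, fun j => ?_⟩, hxb⟩
    obtain ⟨t, ht⟩ := exists_incidence_eq_one hmem j
    have h1 : x j * a j t ≤ ∑ j, x j * a j t :=
      Finset.single_le_sum (f := fun j => x j * a j t)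
        (fun j _ => mul_nonneg (hx0 j) (incidence_nonneg mem j t)) (Finset.mem_univ j)
    have h2 : ∑ j, x j * a j t = b t := by
      rw [← hxb]; simp
    have h3 : a j t = 1 := ht
    rw [h2, h3, mul_one] at h1
    exact h1.trans (hbU t trivial).2.le
  have h1 : (1 : T → ℝ) ∈ Z := by
    refine closure_minimal hsub hZ ((dense_isGenericFor a).open_subset_closure_inter hU ?_)
    intro t _
    simp
  obtain ⟨D, hD, x, ⟨hxD, hx0, -⟩, hx⟩ := Set.mem_iUnion₂.1 h1
  refine ⟨D, x, hD, hx0, hxD, fun t => ?_⟩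
  have := congrFun hx t
  simpa [f] using this

/-- **Scarf's theorem** on balanced collections, for finitely many coalitions `mem k`, each with a
utility vector `c · k`. -/
theorem exists_balanced_weights_threshold [Fintype T] [Nonempty T] [Fintype K]
    {mem : K → Set T} (hmem : ∀ k, (mem k).Nonempty) {c : T → K → ℝ} (hc : ∀ t k, 0 ≤ c t k) :
    ∃ (x : T ⊕ K → ℝ) (u : T → ℝ), (∀ j, 0 ≤ x j) ∧
      (∀ t, ∑ j, x j * incidence mem j t = 1) ∧
      (∀ t, x (Sum.inl t) ≠ 0 → u t ≤ 0) ∧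
      (∀ k, x (Sum.inr k) ≠ 0 → ∀ t ∈ mem k, u t ≤ c t k) ∧
      ∀ k, ∃ t ∈ mem k, c t k ≤ u t := by
  classical
  set M : ℝ := 1 + ∑ t, ∑ k, c t k with hM
  have hcM : ∀ t k, c t k < M := by
    intro t k
    have h1 : c t k ≤ ∑ k, c t k :=
      Finset.single_le_sum (f := fun k => c t k) (fun k _ => hc t k) (Finset.mem_univ k)
    have h2 : ∑ k, c t k ≤ ∑ t, ∑ k, c t k :=
      Finset.single_le_sum (f := fun t => ∑ k, c t k)
        (fun t _ => Finset.sum_nonneg fun k _ => hc t k) (Finset.mem_univ t)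
    linarith
  have hM0 : 0 < M := by
    have : 0 ≤ ∑ t, ∑ k, c t k := Finset.sum_nonneg fun t _ => Finset.sum_nonneg fun k _ => hc t k
    linarith
  -- In row `t` the order is: own singleton, coalitions containing `t`, other coalitions, other
  -- singletons.
  let val : T → T ⊕ K → ℝ := fun t => Sum.elim (fun s => if t = s then -1 else M + 1)
    (fun k => if t ∈ mem k then c t k else M)
  have hval0 : ∀ t k, val t (Sum.inr k) = if t ∈ mem k then c t k else M := fun _ _ => rfl
  have hvalid : ∀ t, val t (Sum.inl t) = -1 := fun t => by simp [val]
  have hvalne : ∀ t s, s ≠ t → val t (Sum.inl s) = M + 1 := fun t s h => by simp [val, h.symm]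
  have hvalM : ∀ t j, incidence mem j t ≠ 0 → val t j < M := by
    rintro t (s | k) h
    · have : t = s := by
        by_contra hts
        simp [incidence, hts] at h
      rw [← this, hvalid]
      linarith
    · have : t ∈ mem k := by
        by_contra hts
        simp [incidence, hts] at h
      rw [hval0, if_pos this]
      exact hcM t k
  -- An enumeration of the columns breaks ties.
  let rk : T → T ⊕ K → ℝ ×ₗ Fin (Fintype.card (T ⊕ K)) :=
    fun t j => toLex (val t j, Fintype.equivFin _ j)
  have hrklt : ∀ t j j', val t j < val t j' → rk t j < rk t j' := fun t j j' h =>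
    Prod.Lex.toLex_lt_toLex.2 (Or.inl h)
  have hrkle : ∀ t j j', rk t j ≤ rk t j' → val t j ≤ val t j' := fun t j j' h =>
    not_lt.1 fun h' => absurd (hrklt t j' j h') (not_lt.2 h)
  obtain ⟨D, x, hD, hx0, hxD, hx⟩ := exists_balanced_dominating (rk := rk)
    (fun t j j' h => by
      have h2 := congrArg (fun p => (ofLex p).2) h
      exact (Fintype.equivFin _).injective h2)
    (fun t k => hrklt _ _ _ (by
      rw [hvalid, hval0]; split_ifs
      · linarith [hc t k]
      · linarith))
    (fun t s k hst => hrklt _ _ _ (by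
      rw [hvalne t s hst, hval0]; split_ifs
      · linarith [hcM t k]
      · linarith))
    (fun t s => by
      by_cases hst : s = t
      · rw [hst]
      · exact (hrklt _ _ _ (by rw [hvalne t s hst, hvalid]; linarith)).le) hmem
  have hex : ∀ t, ∃ d ∈ D, incidence mem d t ≠ 0 := by
    intro t
    by_contra! h
    have h0 : ∑ j, x j * incidence mem j t = 0 := Finset.sum_eq_zero fun j _ => by
      by_cases hj : j ∈ D
      · rw [h j hj, mul_zero]
      · rw [hxD j hj, zero_mul]
    rw [hx t] at h0
    exact one_ne_zero h0
  have hminex : ∀ t, ∃ d ∈ D, ∀ d' ∈ D, val t d ≤ val t d' := fun t =>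
    let ⟨d, hd, _⟩ := hex t
    Finset.exists_min_image D (val t) ⟨d, hd⟩
  choose e heD hmin using hminex
  have hmemD : ∀ j, x j ≠ 0 → j ∈ D := fun j hj => by
    by_contra h
    exact hj (hxD j h)
  refine ⟨x, fun t => val t (e t), hx0, hx, fun t ht => ?_, fun k hk t ht => ?_, fun k => ?_⟩
  · refine (hmin t _ (hmemD _ ht)).trans ?_
    rw [hvalid]
    norm_num
  · refine (hmin t _ (hmemD _ hk)).trans ?_
    rw [hval0, if_pos ht]
  -- Some column of `D` covers `t`, so the minimum of row `t` is below `M`; hence the row dominating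
  -- `inr k` belongs to a member of `k`.
  · obtain ⟨t, ht⟩ := hD (Sum.inr k)
    have hle := hrkle _ _ _ (ht (e t) (heD t))
    have htk : t ∈ mem k := by
      by_contra h
      rw [hval0, if_neg h] at hle
      obtain ⟨d, hd, hdt⟩ := hex t
      exact absurd (hle.trans (hmin t d hd)) (not_le.2 (hvalM t d hdt))
    rw [hval0, if_pos htk] at hle
    exact ⟨t, htk, hle⟩

end ScarfBalanced

/-! ### The core of the economy of types -/

section TypeAgentCore

variable {N T W : Type*} {l : ℕ}

/-- An objection of the coalition `S` on the common-knowledge event `F`: each member holds the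
amount `y t` of goods when of type `t`. Here `τ i w` is the type of player `i` at `w`. -/
structure Objection (τ : N → W → T) (e : T → Fin l → ℝ) where
  S : Finset N
  F : Set W
  S_nonempty : S.Nonempty
  F_nonempty : F.Nonempty
  F_saturated : ∀ i ∈ S, ∀ w w', τ i w = τ i w' → w ∈ F → w' ∈ F
  y : T → Fin l → ℝ
  y_nonneg : ∀ t, 0 ≤ y t
  y_sum : ∀ w ∈ F, ∑ i ∈ S, y (τ i w) = ∑ i ∈ S, e (τ i w)

namespace Objection

variable {τ : N → W → T} {e : T → Fin l → ℝ}

/-- The types involved in an objection. -/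
def types (k : Objection τ e) : Set T := {t | ∃ i ∈ k.S, ∃ w ∈ k.F, τ i w = t}

theorem types_nonempty (k : Objection τ e) : k.types.Nonempty :=
  let ⟨i, hi⟩ := k.S_nonempty
  let ⟨w, hw⟩ := k.F_nonempty
  ⟨τ i w, i, hi, w, hw, rfl⟩

theorem mem_types {owner : T → N} (hτ : ∀ i w, owner (τ i w) = i) (k : Objection τ e) (i : N)
    (w : W) : τ i w ∈ k.types ↔ i ∈ k.S ∧ w ∈ k.F := by
  constructor
  · rintro ⟨j, hj, w', hw', h⟩
    obtain rfl : j = i := by rw [← hτ j w', h, hτ]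
    exact ⟨hj, k.F_saturated j hj w' w h hw'⟩
  · rintro ⟨hi, hw⟩
    exact ⟨i, hi, w, hw, rfl⟩

end Objection

/-- The allocations of the grand coalition, indexed by types. -/
def typeAllocations [Fintype N] (τ : N → W → T) (e : T → Fin l → ℝ) : Set (T → Fin l → ℝ) :=
  {x | (∀ t, 0 ≤ x t) ∧ ∀ w, ∑ i, x (τ i w) = ∑ i, e (τ i w)}

/-- Every type occurs at some state, where its bundle is bounded by the total endowment. -/
theorem isCompact_typeAllocations [Fintype N] {τ : N → W → T} {owner : T → N}
    (hsurj : ∀ t, ∃ w, τ (owner t) w = t) (e : T → Fin l → ℝ) :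
    IsCompact (typeAllocations τ e) := by
  choose ω hω using hsurj
  refine (isCompact_Icc (a := (0 : T → Fin l → ℝ))
    (b := fun t => ∑ i, e (τ i (ω t)))).of_isClosed_subset ?_ ?_
  · have : typeAllocations τ e = (⋂ t, {x | 0 ≤ x t}) ∩
        ⋂ w, {x | ∑ i, x (τ i w) = ∑ i, e (τ i w)} := by
      ext x
      simp [typeAllocations]
    rw [this]
    refine (isClosed_iInter fun t => isClosed_le continuous_const (continuous_apply t)).inter
      (isClosed_iInter fun w => isClosed_eq ?_ continuous_const)
    fun_prop
  · rintro x ⟨hx0, hx⟩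
    refine ⟨hx0, fun t => ?_⟩
    change x t ≤ ∑ i, e (τ i (ω t))
    rw [← hx (ω t)]
    conv_lhs => rw [← hω t]
    exact Finset.single_le_sum (f := fun i => x (τ i (ω t))) (fun i _ => hx0 _)
      (Finset.mem_univ _)

/-- Each type consumes the average of its bundles under Scarf's weights, with singletons
contributing endowments. Jensen's inequality gives it at least the threshold `u t`. -/
theorem exists_allocation_of_finset [Fintype N] [Fintype T] [Nonempty T] {τ : N → W → T}
    {owner : T → N} (hτ : ∀ i w, owner (τ i w) = i) {e : T → Fin l → ℝ} (he : ∀ t, 0 ≤ e t)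
    {U : T → (Fin l → ℝ) → ℝ} (hconc : ∀ t, ConcaveOn ℝ (Set.Ici 0) (U t))
    (hU0 : ∀ t, ∀ v, 0 ≤ v → 0 ≤ U t v) (Q : Finset (Objection τ e)) :
    ∃ x ∈ typeAllocations τ e, ∀ k ∈ Q, ∃ t ∈ k.types, U t (k.y t) ≤ U t (x t) := by
  classical
  let mem : Q → Set T := fun k => k.1.types
  obtain ⟨x, u, hx0, hx, hxl, hxr, hu⟩ := exists_balanced_weights_threshold (mem := mem)
    (fun k => k.1.types_nonempty) (c := fun t k => U t (k.1.y t))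
    (fun t k => hU0 t _ (k.1.y_nonneg t))
  let a : T ⊕ Q → T → ℝ := incidence mem
  have ha0 : ∀ j t, 0 ≤ a j t := incidence_nonneg mem
  let z : T ⊕ Q → T → Fin l → ℝ := Sum.elim (fun _ => e) fun k => k.1.y
  have hz0 : ∀ j t, 0 ≤ z j t := by
    rintro (s | k) t
    · exact he t
    · exact k.1.y_nonneg t
  have hU : ∀ t, u t ≤ U t (∑ j, (x j * a j t) • z j t) := by
    intro t
    have hjensen := (hconc t).le_map_sum (t := Finset.univ) (w := fun j => x j * a j t)
      (p := fun j => z j t) (fun j _ => mul_nonneg (hx0 j) (ha0 j t)) (hx t)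
      (fun j _ => hz0 j t)
    refine le_trans ?_ hjensen
    calc u t = ∑ j, (x j * a j t) * u t := by rw [← Finset.sum_mul, hx t, one_mul]
      _ ≤ _ := by
        refine Finset.sum_le_sum fun j _ => ?_
        by_cases hxj : x j = 0
        · simp [hxj]
        by_cases haj : a j t = 0
        · simp [haj]
        refine mul_le_mul_of_nonneg_left ?_ (mul_nonneg (hx0 j) (ha0 j t))
        rcases j with s | k
        · have hts : t = s := by
            by_contra h
            exact haj (by simp [a, incidence, h])
          subst hts
          exact (hxl t hxj).trans (hU0 t _ (hz0 _ t))
        · refine hxr k hxj t ?_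
          by_contra h
          exact haj (by simp [a, incidence, h])
  refine ⟨fun t => ∑ j, (x j * a j t) • z j t, ⟨fun t => ?_, fun w => ?_⟩, fun k hk => ?_⟩
  · exact Finset.sum_nonneg fun j _ => smul_nonneg (mul_nonneg (hx0 j) (ha0 j t)) (hz0 j t)
  -- At a given state either all members of a coalition are active or none is, because the event is
  -- saturated; so each column preserves the endowment total.
  · have hcol : ∀ j, ∑ i, a j (τ i w) • z j (τ i w) = ∑ i, a j (τ i w) • e (τ i w) := by
      rintro (s | k)
      · rfl
      · have hak : ∀ i, a (Sum.inr k) (τ i w) = if i ∈ k.1.S ∧ w ∈ k.1.F then 1 else 0 := by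
          intro i
          simp only [a, incidence, Sum.elim_inr, mem, k.1.mem_types hτ]
        by_cases hw : w ∈ k.1.F
        · simpa [hak, hw, ite_smul, z] using k.1.y_sum w hw
        · simp [hak, hw]
    calc ∑ i, ∑ j, (x j * a j (τ i w)) • z j (τ i w)
        = ∑ j, x j • ∑ i, a j (τ i w) • z j (τ i w) := by
          rw [Finset.sum_comm]
          simp only [mul_smul, Finset.smul_sum]
      _ = ∑ j, x j • ∑ i, a j (τ i w) • e (τ i w) := by simp only [hcol]
      _ = ∑ i, (∑ j, x j * a j (τ i w)) • e (τ i w) := by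
          simp only [Finset.smul_sum, Finset.sum_smul, mul_smul]
          rw [Finset.sum_comm]
      _ = ∑ i, e (τ i w) := by
          refine Finset.sum_congr rfl fun i _ => ?_
          rw [hx, one_smul]
  · obtain ⟨t, ht, hle⟩ := hu ⟨k, hk⟩
    exact ⟨t, ht, hle.trans (hU t)⟩

/-- The core of the exchange economy whose agents are the types is nonempty. -/
theorem exists_mem_core_of_types [Fintype N] [Finite T] [Nonempty T] {τ : N → W → T}
    {owner : T → N} (hτ : ∀ i w, owner (τ i w) = i) (hsurj : ∀ t, ∃ w, τ (owner t) w = t)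
    {e : T → Fin l → ℝ} (he : ∀ t, 0 ≤ e t)
    {U : T → (Fin l → ℝ) → ℝ} (hconc : ∀ t, ConcaveOn ℝ (Set.Ici 0) (U t))
    (hU0 : ∀ t, ∀ v, 0 ≤ v → 0 ≤ U t v)
    (hclosed : ∀ t c, IsClosed {v : Fin l → ℝ | 0 ≤ v ∧ c ≤ U t v}) :
    ∃ x ∈ typeAllocations τ e, ∀ k : Objection τ e, ∃ t ∈ k.types, U t (k.y t) ≤ U t (x t) := by
  have := Fintype.ofFinite T
  let Z : Objection τ e → Set (T → Fin l → ℝ) := fun k =>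
    ⋃ t ∈ k.types, {x | 0 ≤ x t ∧ U t (k.y t) ≤ U t (x t)}
  -- Finite intersection property: each `Z k` is a finite union of closed sets.
  obtain ⟨x, hx, hxZ⟩ := (isCompact_typeAllocations hsurj e).inter_iInter_nonempty Z
    (fun k => (Set.toFinite _).isClosed_biUnion fun t _ =>
      IsClosed.preimage (f := fun x : T → Fin l → ℝ => x t) (continuous_apply t)
        (hclosed t (U t (k.y t))))
    (fun Q => by
      obtain ⟨x, hx, hxQ⟩ := exists_allocation_of_finset hτ he hconc hU0 Q
      refine ⟨x, hx, Set.mem_iInter₂.2 fun k hk => ?_⟩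
      obtain ⟨t, ht, hle⟩ := hxQ k hk
      exact Set.mem_biUnion ht ⟨hx.1 t, hle⟩)
  refine ⟨x, hx, fun k => ?_⟩
  obtain ⟨t, ht, hle⟩ := Set.mem_iUnion₂.1 (Set.mem_iInter.1 hxZ k)
  exact ⟨t, ht, hle.2⟩

end TypeAgentCore

/-! ### Atoms of finite σ-algebras -/

section FiniteSigmaAlgebra

variable {Ω : Type*}

/-- Each cell of the partition is contained in or disjoint from a measurable set, which is thus a
union of cells. -/
theorem finite_measurableSet_generateFrom {P : Set (Set Ω)} (hP : P.Finite)
    (hpart : Setoid.IsPartition P) :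
    {s | MeasurableSet[MeasurableSpace.generateFrom P] s}.Finite := by
  have key : ∀ s, MeasurableSet[MeasurableSpace.generateFrom P] s →
      ∀ A ∈ P, A ⊆ s ∨ Disjoint A s := by
    intro s hs
    induction s, hs using MeasurableSpace.generateFrom_induction with
    | hC s hs _ =>
      intro A hA
      by_cases h : A = s
      · exact Or.inl h.le
      · exact Or.inr (hpart.pairwiseDisjoint hA hs h)
    | empty => exact fun A _ => Or.inr (Set.disjoint_empty A)
    | compl s _ ih =>
      intro A hA
      rcases ih A hA with h | h
      · exact Or.inr (Set.disjoint_compl_right_iff_subset.2 h)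
      · exact Or.inl (Set.subset_compl_iff_disjoint_right.2 h)
    | iUnion s _ ih =>
      intro A hA
      by_cases h : ∃ n, A ⊆ s n
      · obtain ⟨n, hn⟩ := h
        exact Or.inl (hn.trans (Set.subset_iUnion s n))
      · push Not at h
        exact Or.inr (Set.disjoint_iUnion_right.2 fun n => (ih n A hA).resolve_left (h n))
  refine (hP.finite_subsets.image Set.sUnion).subset fun s hs =>
    ⟨{A | A ∈ P ∧ A ⊆ s}, fun A hA => hA.1, ?_⟩
  refine Set.Subset.antisymm (Set.sUnion_subset fun A hA => hA.2) fun w hw => ?_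
  obtain ⟨A, hA, hwA⟩ := Set.mem_sUnion.1 (hpart.sUnion_eq_univ ▸ Set.mem_univ w)
  exact ⟨A, ⟨hA, (key s hs A hA).resolve_right fun h => Set.disjoint_left.1 h hwA hw⟩, hwA⟩

variable {m m₀ : MeasurableSpace Ω}

theorem measurableSet_measurableAtom_of_finite (h : {s | MeasurableSet[m] s}.Finite) (w : Ω) :
    MeasurableSet[m] (@measurableAtom Ω m w) := by
  have : @measurableAtom Ω m w = ⋂₀ {s | MeasurableSet[m] s ∧ w ∈ s} := by
    ext x
    simp only [measurableAtom, Set.mem_iInter, Set.mem_sInter, Set.mem_ofPred_eq]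
    exact ⟨fun hx s hs => hx s hs.2 hs.1, fun hx s h1 h2 => hx s ⟨h2, h1⟩⟩
  rw [this]
  exact MeasurableSet.sInter ((h.subset fun s hs => hs.1).countable) fun s hs => hs.1

theorem measurableAtom_mono (h : m ≤ m₀) (w : Ω) :
    @measurableAtom Ω m₀ w ⊆ @measurableAtom Ω m w := by
  intro x hx
  simp only [measurableAtom, Set.mem_iInter] at hx ⊢
  exact fun s hws hs => hx s hws (h s hs)

theorem Measurable.eq_of_mem_measurableAtom {β : Type*} [MeasurableSpace β]
    [MeasurableSingletonClass β] {f : Ω → β} (hf : Measurable[m] f) {w w' : Ω}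
    (h : w' ∈ @measurableAtom Ω m w) : f w' = f w :=
  mem_of_mem_measurableAtom (s := f ⁻¹' {f w}) h (hf (measurableSet_singleton _)) rfl

theorem mem_iff_of_mem_measurableAtom {s : Set Ω} (hs : MeasurableSet[m] s) {w w' : Ω}
    (h : w' ∈ @measurableAtom Ω m w) : w' ∈ s ↔ w ∈ s := by
  constructor
  · intro hw'
    by_contra hw
    exact mem_of_mem_measurableAtom h hs.compl hw hw'
  · exact fun hw => mem_of_mem_measurableAtom h hs hw

theorem measurable_of_measurableAtom {β : Type*} [MeasurableSpace β]
    (h : {s | MeasurableSet[m] s}.Finite) (g : Set Ω → β) :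
    Measurable[m] fun w => g (@measurableAtom Ω m w) := by
  intro s _
  have : (fun w => g (@measurableAtom Ω m w)) ⁻¹' s =
      ⋃₀ (@measurableAtom Ω m '' ((fun w => g (@measurableAtom Ω m w)) ⁻¹' s)) := by
    ext w
    simp only [Set.mem_preimage, Set.sUnion_image, Set.mem_iUnion, exists_prop]
    constructor
    · exact fun hw => ⟨w, hw, mem_measurableAtom_self w⟩
    · rintro ⟨w', hw', hw⟩
      rwa [measurableAtom_eq_of_mem hw]
  rw [this]
  have hfin : ∀ A ∈ (@measurableAtom Ω m '' ((fun w => g (@measurableAtom Ω m w)) ⁻¹' s)),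
      MeasurableSet[m] A := by
    rintro _ ⟨w, -, rfl⟩
    exact measurableSet_measurableAtom_of_finite h w
  exact MeasurableSet.sUnion (h.subset hfin).countable hfin

theorem ae_measure_measurableAtom_ne_zero [MeasurableSpace Ω] (μ : Measure Ω)
    (h : {s | MeasurableSet[m] s}.Finite) : ∀ᵐ w ∂μ, μ (@measurableAtom Ω m w) ≠ 0 := by
  have hnull : μ (⋃₀ {A | MeasurableSet[m] A ∧ μ A = 0}) = 0 :=
    (measure_sUnion_null_iff (h.subset fun A hA => hA.1).countable).2 fun A hA => hA.2
  filter_upwards [measure_eq_zero_iff_ae_notMem.1 hnull] with w hw h0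
  exact hw ⟨_, ⟨measurableSet_measurableAtom_of_finite h w, h0⟩,
    @mem_measurableAtom_self Ω m w⟩

/-- Used to turn almost sure relations into relations at every state of a non-null atom. -/
theorem of_ae_of_measure_measurableAtom_ne_zero [MeasurableSpace Ω] {μ : Measure Ω} {p : Ω → Prop}
    (hp : ∀ᵐ w ∂μ, p w) {w : Ω} (hw : μ (@measurableAtom Ω m w) ≠ 0)
    (hinv : ∀ w' ∈ @measurableAtom Ω m w, p w' → p w) : p w := by
  by_contra hn
  exact hw (measure_mono_null (fun w' hw' h => hn (hinv w' hw' h)) (ae_iff.1 hp))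

end FiniteSigmaAlgebra

/-! ### Upper semicontinuity of integral functionals -/

section IntegralFunctional

theorem integral_lt_integral_of_ae_lt {α : Type*} [MeasurableSpace α] {ν : Measure α} {f g : α → ℝ}
    (hf : Integrable f ν) (hg : Integrable g ν) (h : ∀ᵐ x ∂ν, f x < g x) (hν : ν ≠ 0) :
    ∫ x, f x ∂ν < ∫ x, g x ∂ν := by
  refine lt_of_le_of_ne (integral_mono_ae hf hg (h.mono fun x hx => hx.le)) fun heq => hν ?_
  have hz : ∫ x, (g x - f x) ∂ν = 0 := by rw [integral_sub hg hf, heq, sub_self]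
  have h0 := (integral_eq_zero_iff_of_nonneg_ae (h.mono fun x hx => (sub_pos.2 hx).le)
    (hg.sub hf)).1 hz
  have hfalse : ∀ᵐ _ ∂ν, False := by
    filter_upwards [h, h0] with x hx hx0
    exact (sub_pos.2 hx).ne' hx0
  rwa [Filter.eventually_false_iff_eq_bot, ae_eq_bot] at hfalse

open Filter Topology in
-- Reverse Fatou along a convergent sequence, with dominating function `g`, combined with pointwise
-- upper semicontinuity.
theorem isClosed_le_integral {X α : Type*} [TopologicalSpace X] [SequentialSpace X]
    [MeasurableSpace α] {ν : Measure α} {C : Set X} (hC : IsClosed C) {ψ : X → α → ℝ}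
    (hψ0 : ∀ v ∈ C, ∀ w, 0 ≤ ψ v w) (hψm : ∀ v ∈ C, Measurable (ψ v)) {g : α → ℝ}
    (hg : Integrable g ν) (hψg : ∀ᵐ w ∂ν, ∀ v ∈ C, |ψ v w| ≤ g w)
    (husc : ∀ w, UpperSemicontinuousOn (fun v => ψ v w) C) (c : ℝ) :
    IsClosed {v | v ∈ C ∧ c ≤ ∫ w, ψ v w ∂ν} := by
  have hint : ∀ v ∈ C, Integrable (ψ v) ν := fun v hv =>
    hg.mono' (hψm v hv).aestronglyMeasurable (hψg.mono fun w hw => hw v hv)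
  have hofReal : ∀ v ∈ C, ENNReal.ofReal (∫ w, ψ v w ∂ν) = ∫⁻ w, ENNReal.ofReal (ψ v w) ∂ν :=
    fun v hv => ofReal_integral_eq_lintegral_ofReal (hint v hv) (ae_of_all _ (hψ0 v hv))
  refine IsSeqClosed.isClosed fun v a hv hva => ?_
  have haC : a ∈ C := hC.isSeqClosed (fun n => (hv n).1) hva
  refine ⟨haC, ?_⟩
  rw [← ENNReal.ofReal_le_ofReal_iff (integral_nonneg (hψ0 a haC)), hofReal a haC]
  have hlim : Tendsto v atTop (𝓝[C] a) :=
    tendsto_nhdsWithin_iff.2 ⟨hva, Eventually.of_forall fun n => (hv n).1⟩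
  calc ENNReal.ofReal c
      ≤ limsup (fun n => ∫⁻ w, ENNReal.ofReal (ψ (v n) w) ∂ν) atTop := by
        refine le_limsup_of_frequently_le (Frequently.of_forall fun n => ?_)
        rw [← hofReal _ (hv n).1]
        exact ENNReal.ofReal_le_ofReal (hv n).2
    _ ≤ ∫⁻ w, limsup (fun n => ENNReal.ofReal (ψ (v n) w)) atTop ∂ν := by
        refine limsup_lintegral_le (fun w => ENNReal.ofReal (g w))
          (fun n => (hψm _ (hv n).1).ennreal_ofReal) (fun n => ?_) hg.lintegral_lt_top.ne
        filter_upwards [hψg] with w hw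
        exact ENNReal.ofReal_le_ofReal ((le_abs_self _).trans (hw _ (hv n).1))
    _ ≤ ∫⁻ w, ENNReal.ofReal (ψ a w) ∂ν := by
        refine lintegral_mono fun w => le_of_forall_gt_imp_ge_of_dense fun y hy => ?_
        by_cases hyt : y = ⊤
        · simp [hyt]
        rw [ENNReal.ofReal_lt_iff_lt_toReal (hψ0 a haC w) hyt] at hy
        refine limsup_le_of_le (h := (hlim.eventually (husc w a haC _ hy)).mono fun n hn => ?_)
        rw [← ENNReal.ofReal_toReal hyt]
        exact ENNReal.ofReal_le_ofReal (le_of_lt hn)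

end IntegralFunctional

/-! ### Reduction of the interim economy to types -/

namespace InterimEconomy

variable {Ω : Type*} [MeasurableSpace Ω] {μ : Measure Ω} {N : Type*} {l : ℕ}
  (E : InterimEconomy μ N l)

theorem finite_measurableSet_iSup_info : {s | MeasurableSet[⨆ i, E.info i] s}.Finite := by
  obtain ⟨P, hP, hpart, h⟩ := E.info_finite
  rw [h]
  exact finite_measurableSet_generateFrom hP hpart

theorem finite_measurableSet_info (i : N) : {s | MeasurableSet[E.info i] s}.Finite :=
  E.finite_measurableSet_iSup_info.subset fun s hs => le_iSup E.info i s hs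

theorem measurable_util_comp (i : N) {z : Ω → Fin l → ℝ} (hz : Measurable z) (hz0 : ∀ w, 0 ≤ z w) :
    Measurable fun w => E.util i (z w) w :=
  (E.util_measurable i).comp
    (f := fun w => ((⟨z w, hz0 w⟩ : consumptionSet l), w)) (by fun_prop)

theorem integrable_util_comp (i : N) {z : Ω → Fin l → ℝ} (hz : Measurable z)
    (hz0 : ∀ w, 0 ≤ z w) : Integrable (fun w => E.util i (z w) w) μ := by
  obtain ⟨g, hg, hb⟩ := E.util_bounded i
  exact hg.mono' (E.measurable_util_comp i hz hz0).aestronglyMeasurable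
    (hb.mono fun w hw => hw _ (hz0 w))

theorem setIntegral_interimUtility [IsFiniteMeasure μ] (i : N) {z : Ω → Fin l → ℝ}
    (hz : Measurable z) (hz0 : ∀ w, 0 ≤ z w) {A : Set Ω} (hA : MeasurableSet[E.info i] A) :
    ∫ w in A, E.interimUtility i z w ∂μ = ∫ w in A, E.util i (z w) w ∂μ :=
  setIntegral_condExp (E.info_le i) (E.integrable_util_comp i hz hz0) hA

theorem concaveOn_setIntegral_util {i : N}
    (h : ∀ w, ConcaveOn ℝ (consumptionSet l) (fun a => E.util i a w)) (A : Set Ω) :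
    ConcaveOn ℝ (Set.Ici 0) fun v => ∫ w in A, E.util i v w ∂μ := by
  have hint : ∀ v : Fin l → ℝ, 0 ≤ v → IntegrableOn (fun w => E.util i v w) A μ := fun v hv =>
    (E.integrable_util_comp i measurable_const fun _ => hv).integrableOn
  refine ⟨convex_Ici 0, fun v hv v' hv' a b ha hb hab => ?_⟩
  have hmem : 0 ≤ a • v + b • v' := convex_Ici (𝕜 := ℝ) (0 : Fin l → ℝ) hv hv' ha hb hab
  simp only [smul_eq_mul]
  rw [← integral_const_mul, ← integral_const_mul,
    ← integral_add ((hint v hv).const_mul a) ((hint v' hv').const_mul b)]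
  exact integral_mono (((hint v hv).const_mul a).add ((hint v' hv').const_mul b)) (hint _ hmem)
    fun w => (h w).2 hv hv' ha hb hab

theorem isClosed_le_setIntegral_util {i : N}
    (h : ∀ w, UpperSemicontinuousOn (fun a => E.util i a w) (consumptionSet l)) (A : Set Ω)
    (c : ℝ) : IsClosed {v : Fin l → ℝ | 0 ≤ v ∧ c ≤ ∫ w in A, E.util i v w ∂μ} := by
  obtain ⟨g, hg, hb⟩ := E.util_bounded i
  exact isClosed_le_integral (C := consumptionSet l) isClosed_Ici (E.util_nonneg i)
    (fun v hv => E.measurable_util_comp i measurable_const fun _ => hv) hg.integrableOn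
    (ae_restrict_of_ae hb) h c

/-- The event that the atom of the joint information has positive probability. -/
def positiveStates : Set Ω := {w | μ (@measurableAtom Ω (⨆ i, E.info i) w) ≠ 0}

theorem ae_mem_positiveStates : ∀ᵐ w ∂μ, w ∈ E.positiveStates :=
  ae_measure_measurableAtom_ne_zero μ E.finite_measurableSet_iSup_info

/-- The atom of the information field of player `i` at `w`. -/
def infoAtom (i : N) (w : Ω) : Set Ω := @measurableAtom Ω (E.info i) w

/-- The types: a player together with an atom of the player's information that meets the positive
states. -/
def PlayerType : Type _ := {p : N × Set Ω // ∃ w ∈ E.positiveStates, p.2 = E.infoAtom p.1 w}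

/-- The type of player `i` at a positive state. -/
def playerType (i : N) (w : E.positiveStates) : E.PlayerType :=
  ⟨(i, E.infoAtom i w), w, w.2, rfl⟩

variable {E}

theorem finite_playerType [Finite N] : Finite E.PlayerType := by
  have : {p : N × Set Ω | ∃ w ∈ E.positiveStates, p.2 = E.infoAtom p.1 w}.Finite := by
    refine (Set.finite_univ.prod E.finite_measurableSet_iSup_info).subset ?_
    rintro ⟨i, A⟩ ⟨w, -, hA⟩
    simp only at hA
    subst hA
    exact ⟨trivial, le_iSup E.info i _
      (measurableSet_measurableAtom_of_finite (E.finite_measurableSet_info i) w)⟩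
  exact this.to_subtype

namespace PlayerType

/-- The player having a given type. -/
def owner (t : E.PlayerType) : N := t.1.1

/-- A state at which the owner has the given type. -/
noncomputable def state (t : E.PlayerType) : E.positiveStates :=
  ⟨t.2.choose, t.2.choose_spec.1⟩

theorem playerType_state (t : E.PlayerType) : E.playerType t.owner t.state = t :=
  Subtype.ext (Prod.ext rfl t.2.choose_spec.2.symm)

theorem apply_state_playerType {β : Type*} [MeasurableSpace β] [MeasurableSingletonClass β]
    {i : N} {f : Ω → β} (hf : Measurable[E.info i] f) (w : E.positiveStates) :
    f (E.playerType i w).state = f w := by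
  refine hf.eq_of_mem_measurableAtom (m := E.info i) ?_
  have h : E.infoAtom i w = E.infoAtom i (E.playerType i w).state :=
    (E.playerType i w).2.choose_spec.2
  change _ ∈ E.infoAtom i w
  rw [h]
  exact @mem_measurableAtom_self Ω (E.info i) _

end PlayerType

theorem mem_infoAtom_self (i : N) (w : Ω) : w ∈ E.infoAtom i w :=
  @mem_measurableAtom_self Ω (E.info i) w

theorem measurableSet_infoAtom (i : N) (w : Ω) : MeasurableSet[E.info i] (E.infoAtom i w) :=
  measurableSet_measurableAtom_of_finite (E.finite_measurableSet_info i) w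

theorem measure_infoAtom_ne_zero (i : N) (w : E.positiveStates) : μ (E.infoAtom i w) ≠ 0 :=
  fun h => w.2 (measure_mono_null (measurableAtom_mono (le_iSup E.info i) _) h)

theorem of_ae_of_mem_positiveStates {p : Ω → Prop} (hp : ∀ᵐ w ∂μ, p w) {w : Ω}
    (hw : w ∈ E.positiveStates)
    (hinv : ∀ w' ∈ @measurableAtom Ω (⨆ i, E.info i) w, p w' → p w) : p w :=
  of_ae_of_measure_measurableAtom_ne_zero hp hw hinv

theorem eq_of_mem_jointAtom {β : Type*} [MeasurableSpace β] [MeasurableSingletonClass β]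
    {i : N} {f : Ω → β} (hf : Measurable[E.info i] f) {w w' : Ω}
    (h : w' ∈ @measurableAtom Ω (⨆ i, E.info i) w) : f w' = f w :=
  hf.eq_of_mem_measurableAtom (measurableAtom_mono (le_iSup E.info i) _ h)

open Classical in
/-- The allocation given by a choice of goods for every type. -/
noncomputable def ofTypes (E : InterimEconomy μ N l) (x : E.PlayerType → Fin l → ℝ) (i : N)
    (w : Ω) : Fin l → ℝ :=
  -- The default 0 is used only at states outside `positiveStates`, a null set.
  if h : ∃ w' ∈ E.positiveStates, E.infoAtom i w = E.infoAtom i w' then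
    x ⟨(i, E.infoAtom i w), h⟩ else 0

theorem ofTypes_apply (x : E.PlayerType → Fin l → ℝ) (i : N) (w : E.positiveStates) :
    E.ofTypes x i w = x (E.playerType i w) :=
  dif_pos ⟨w, w.2, rfl⟩

theorem ofTypes_nonneg {x : E.PlayerType → Fin l → ℝ} (hx : ∀ t, 0 ≤ x t) (i : N) (w : Ω) :
    0 ≤ E.ofTypes x i w := by
  unfold ofTypes
  split_ifs
  · exact hx _
  · exact le_rfl

open Classical in
theorem measurable_ofTypes (x : E.PlayerType → Fin l → ℝ) (i : N) :
    Measurable[E.info i] (E.ofTypes x i) :=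
  measurable_of_measurableAtom (E.finite_measurableSet_info i) fun A =>
    if h : ∃ w' ∈ E.positiveStates, A = E.infoAtom i w' then x ⟨(i, A), h⟩ else 0

/-- The expected utility of a type, that is, the integral of the utility of the owner over the
atom. -/
noncomputable def typeUtility (t : E.PlayerType) (v : Fin l → ℝ) : ℝ :=
  ∫ w in t.1.2, E.util t.1.1 v w ∂μ

/-- The atom belongs to the player's field, so integrating over it removes the conditional
expectation, and `z` is constant there. -/
theorem setIntegral_interimUtility_infoAtom [IsFiniteMeasure μ] {i : N} {z : Ω → Fin l → ℝ}
    (hz : Measurable[E.info i] z) (hz0 : ∀ w, 0 ≤ z w) (w : E.positiveStates) :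
    ∫ w' in E.infoAtom i w, E.interimUtility i z w' ∂μ =
      typeUtility (E.playerType i w) (z w) := by
  have hA := measurableSet_infoAtom (E := E) i (w : Ω)
  rw [E.setIntegral_interimUtility i (hz.mono (E.info_le i) le_rfl) hz0 hA]
  refine setIntegral_congr_fun (E.info_le i _ hA) fun w' hw' => ?_
  simp only [hz.eq_of_mem_measurableAtom hw']
  rfl

open Classical in
/-- A blocking coalition yields an objection of types. -/
theorem Blocks.exists_objection [IsFiniteMeasure μ] {S : Finset N} {x : N → Ω → Fin l → ℝ}
    (hx : ∀ i ∈ S, (∀ w, x i w ∈ consumptionSet l) ∧ Measurable[E.info i] (x i))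
    (h : E.Blocks S x) :
    ∃ k : Objection E.playerType (fun t => E.endow t.owner t.state),
      ∀ i w, E.playerType i w ∈ k.types →
        typeUtility (E.playerType i w) (x i w) <
          typeUtility (E.playerType i w) (k.y (E.playerType i w)) := by
  obtain ⟨hS, F, ⟨hFm, hF⟩, hF0, y, ⟨hy, hysum⟩, hlt⟩ := h
  choose! G hG hFG using hF
  obtain ⟨i₀, hi₀⟩ := id hS
  -- The members' versions of `F` agree almost surely and are unions of joint atoms, so they agree
  -- at every positive state. This makes the event of the objection saturated for all members.
  have hGiff : ∀ i ∈ S, ∀ w ∈ E.positiveStates, w ∈ G i ↔ w ∈ G i₀ := by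
    intro i hi w hw
    refine of_ae_of_mem_positiveStates (p := fun w => w ∈ G i ↔ w ∈ G i₀) ?_ hw
      fun w' hw' hp => ?_
    · filter_upwards [hFG i hi, hFG i₀ hi₀] with w h1 h2
      exact (iff_of_eq h1).symm.trans (iff_of_eq h2)
    · rw [← mem_iff_of_mem_measurableAtom (le_iSup E.info i _ (hG i hi)) hw', hp,
        mem_iff_of_mem_measurableAtom (le_iSup E.info i₀ _ (hG i₀ hi₀)) hw']
  have hyτ : ∀ i ∈ S, ∀ w, y i (E.playerType i w).state = y i w := fun i hi w =>
    PlayerType.apply_state_playerType (hy i hi).2 w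
  let k : Objection E.playerType (fun t => E.endow t.owner t.state) :=
    { S := S
      F := {w | (w : Ω) ∈ G i₀}
      S_nonempty := hS
      F_nonempty := by
        by_contra hne
        refine hF0 ?_
        rw [measure_congr (hFG i₀ hi₀), measure_eq_zero_iff_ae_notMem]
        filter_upwards [E.ae_mem_positiveStates] with w hw hwG
        exact hne ⟨⟨w, hw⟩, hwG⟩
      F_saturated := by
        intro i hi w w' hww' hw
        have hatom : E.infoAtom i w = E.infoAtom i w' :=
          congrArg (fun t : E.PlayerType => t.1.2) hww'
        refine (hGiff i hi w' w'.2).1 ?_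
        refine (mem_iff_of_mem_measurableAtom (hG i hi) ?_).2 ((hGiff i hi w w.2).2 hw)
        change (w' : Ω) ∈ E.infoAtom i w
        rw [hatom]
        exact mem_infoAtom_self i _
      y := fun t => if t.owner ∈ S then y t.owner t.state else 0
      y_nonneg := by
        intro t
        split_ifs with ht
        · exact (hy _ ht).1 _
        · exact le_rfl
      y_sum := by
        intro w _
        have h1 : ∑ i ∈ S, y i w = ∑ i ∈ S, E.endow i w := by
          refine of_ae_of_mem_positiveStates hysum w.2 fun w' hw' hp => ?_
          rw [← Finset.sum_congr rfl fun i hi => eq_of_mem_jointAtom (hy i hi).2 hw', hp]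
          exact Finset.sum_congr rfl fun i _ => eq_of_mem_jointAtom (E.endow_measurable i) hw'
        have h2 : ∀ i ∈ S, (if (E.playerType i w).owner ∈ S then
            y (E.playerType i w).owner (E.playerType i w).state else 0) = y i w := fun i hi => by
          rw [← hyτ i hi w]
          exact if_pos hi
        rw [Finset.sum_congr rfl h2, h1]
        exact Finset.sum_congr rfl fun i _ =>
          (PlayerType.apply_state_playerType (E.endow_measurable i) w).symm }
  refine ⟨k, fun i w hk => ?_⟩
  obtain ⟨hi, hw⟩ := (k.mem_types (owner := PlayerType.owner) (fun _ _ => rfl) i w).1 hk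
  have hky : k.y (E.playerType i w) = y i w := by
    rw [← hyτ i hi w]
    exact if_pos hi
  rw [hky, ← setIntegral_interimUtility_infoAtom (hx i hi).2 (hx i hi).1,
    ← setIntegral_interimUtility_infoAtom (hy i hi).2 (hy i hi).1]
  -- The atom is non-null and almost surely inside `F`, so the strict interim inequality survives
  -- integration.
  refine integral_lt_integral_of_ae_lt integrable_condExp.integrableOn
    integrable_condExp.integrableOn ?_ ?_
  · have hA := E.info_le i _ (measurableSet_infoAtom (E := E) i (w : Ω))
    rw [ae_restrict_iff' hA]
    filter_upwards [hlt i hi, hFG i hi] with w' h1 h2 h3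
    refine h1 ((iff_of_eq h2).2 ?_)
    exact (mem_iff_of_mem_measurableAtom (hG i hi) h3).2 ((hGiff i hi w w.2).2 hw)
  · rw [Ne, Measure.restrict_eq_zero]
    exact measure_infoAtom_ne_zero i w

end InterimEconomy

theorem theorem4 {Ω : Type*} [MeasurableSpace Ω] (μ : Measure Ω) [IsProbabilityMeasure μ]
    {N : Type*} [Fintype N] {l : ℕ} (E : InterimEconomy μ N l)
    (hconcave : ∀ i w, ConcaveOn ℝ (consumptionSet l) (fun a => E.util i a w))
    (husc : ∀ i w, UpperSemicontinuousOn (fun a => E.util i a w) (consumptionSet l)) :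
    E.interimCore.Nonempty := by
  rcases isEmpty_or_nonempty N with hN | ⟨⟨i⟩⟩
  · refine ⟨fun _ _ => 0, ⟨fun i => isEmptyElim i, by simp⟩, fun S hS => ?_⟩
    obtain ⟨⟨i, -⟩, -⟩ := hS
    exact isEmptyElim i
  -- Total mass one yields a positive state, hence a type.
  obtain ⟨w, hw⟩ := E.ae_mem_positiveStates.exists
  have : Nonempty E.PlayerType := ⟨E.playerType i ⟨w, hw⟩⟩
  have : Finite E.PlayerType := InterimEconomy.finite_playerType
  obtain ⟨x, ⟨hx0, hxsum⟩, hx⟩ := exists_mem_core_of_types (τ := E.playerType)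
    (owner := InterimEconomy.PlayerType.owner) (fun _ _ => rfl)
    (fun t => ⟨t.state, t.playerType_state⟩) (e := fun t => E.endow t.owner t.state)
    (fun t => E.endow_mem _ _) (U := InterimEconomy.typeUtility)
    (fun t => E.concaveOn_setIntegral_util (hconcave t.1.1) t.1.2)
    (fun t v hv => integral_nonneg fun w => E.util_nonneg t.1.1 v hv w)
    (fun t c => E.isClosed_le_setIntegral_util (husc t.1.1) t.1.2 c)
  have hmem : ∀ i, (∀ w, E.ofTypes x i w ∈ consumptionSet l) ∧
      Measurable[E.info i] (E.ofTypes x i) := fun i =>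
    ⟨InterimEconomy.ofTypes_nonneg hx0 i, InterimEconomy.measurable_ofTypes x i⟩
  refine ⟨E.ofTypes x, ⟨fun i _ => hmem i, ?_⟩, fun S hS => ?_⟩
  · filter_upwards [E.ae_mem_positiveStates] with w hw
    have h1 : ∀ i, E.ofTypes x i w = x (E.playerType i ⟨w, hw⟩) := fun i =>
      InterimEconomy.ofTypes_apply x i ⟨w, hw⟩
    simp only [h1, hxsum]
    exact Finset.sum_congr rfl fun i _ =>
      InterimEconomy.PlayerType.apply_state_playerType (E.endow_measurable i) ⟨w, hw⟩
  · obtain ⟨k, hk⟩ := hS.exists_objection fun i _ => hmem i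
    obtain ⟨t, ht, hle⟩ := hx k
    obtain ⟨i, -, w, -, rfl⟩ := id ht
    have := hk i w ht
    rw [InterimEconomy.ofTypes_apply] at this
    exact absurd hle (not_le.2 this)
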